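/- There is an absolute constant $c>0$ (the same for (a) and (b), independent of $n,m,N,h,\varepsilon,k$) such that the following holds. Let $n,m,N$ be positive integers, let $h\in\mathbb R^m$ be a non-zero vector, and let $\Psi=(\Psi_j)_{j=1}^N$ be a random dictionary of matrices $\Psi_j\in\mathbb R^{n\times m}$ such that either (a) all entries of $\Psi_1,\dots,\Psi_N$ are independent standard normal random variables (Gaussian ensemble), or (b) all entries of $\Psi_1,\dots,\Psi_N$ are independent and take each of the values $+1$ and $-1$ with probability $1/2$ (Bernoulli ensemble). Let $\mathbb K$ be $\mathbb R$ or $\mathbb C$. If $\varepsilon>0$ and the integer $k\ge 0$ satisfies $$k\le c\,\frac{n}{\max\{1,\ \log(N/(n\varepsilon))\}},$$ then with probability at least $1-\varepsilon$ Basis Pursuit recovers from $\Gamma h$ all matrices $\Gamma$ that have a $k$-sparse representation in $\Psi$. That is: there is an event of probability at least $1-\varepsilon$ on which, for every $x\in\mathbb K^N$ with exactly $k$ non-zero entries and $\Gamma=\sum_{j=1}^N x_j\Psi_j$, the vector $x$ is the unique solution of $$\min_{x'\in\mathbb K^N}\ \sum_{j=1}^N|x'_j|\quad\text{subject to}\quad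 \sum_{j=1}^N x'_j\,\Psi_j h=\Gamma h .$$ -/

import Mathlib

open MeasureTheory ProbabilityTheory

namespace SparseMatrixIdentification

section Deterministic

variable {𝕜 : Type*} [RCLike 𝕜] {n m N : ℕ}

/-- The number of non-zero entries of `x`. -/
noncomputable def l0norm (x : Fin N → 𝕜) : ℕ := {j | x j ≠ 0}.ncard

/-- The `ℓ₁`-norm, the sum of the absolute values of the entries of `x`. -/
noncomputable def l1norm (x : Fin N → 𝕜) : ℝ := ∑ j, ‖x j‖

/-- `x` is the coefficient vector of a `k`-sparse representation of `Γ` in the matrix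
dictionary `Ψ`. -/
def IsSparseRepresentation (Ψ : Fin N → Matrix (Fin n) (Fin m) 𝕜) (k : ℕ)
    (Γ : Matrix (Fin n) (Fin m) 𝕜) (x : Fin N → 𝕜) : Prop :=
  Γ = ∑ j, x j • Ψ j ∧ l0norm x = k

/-- The `n × N` matrix `(Ψ h)` whose `j`-th column is `Ψ j *ᵥ h`. -/
def dictionaryMatrix (Ψ : Fin N → Matrix (Fin n) (Fin m) 𝕜) (h : Fin m → 𝕜) :
    Matrix (Fin n) (Fin N) 𝕜 :=
  Matrix.of fun i j => (Ψ j).mulVec h i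

/-- `x` solves the Basis Pursuit problem: minimize `‖x'‖₁` subject to `(Ψ h) x' = y`. -/
def IsBasisPursuitSolution (Ψ : Fin N → Matrix (Fin n) (Fin m) 𝕜) (h : Fin m → 𝕜)
    (y : Fin n → 𝕜) (x : Fin N → 𝕜) : Prop :=
  (dictionaryMatrix Ψ h).mulVec x = y ∧
    ∀ x' : Fin N → 𝕜, (dictionaryMatrix Ψ h).mulVec x' = y → l1norm x ≤ l1norm x'

/-- Basis Pursuit recovers from `Γ h` every matrix `Γ` that has a `k`-sparse representation
in `Ψ`: for every such `Γ` and every coefficient vector `x` of a `k`-sparse representation of `Γ`,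
the one and only Basis Pursuit solution for the data `Γ h` is `x` (so that the matrix synthesized
from the Basis Pursuit solution is `Γ`). -/
def BasisPursuitRecoversAll (Ψ : Fin N → Matrix (Fin n) (Fin m) 𝕜) (h : Fin m → 𝕜)
    (k : ℕ) : Prop :=
  ∀ (Γ : Matrix (Fin n) (Fin m) 𝕜) (x : Fin N → 𝕜), IsSparseRepresentation Ψ k Γ x →
    ∀ x' : Fin N → 𝕜, IsBasisPursuitSolution Ψ h (Γ.mulVec h) x' ↔ x' = x

end Deterministic

section Random

variable {Ω : Type*} [MeasurableSpace Ω] {n m N : ℕ}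

/-- All entries of all the matrices of the random dictionary `Ψ` are independent, and each of them
has the distribution `μ`. -/
def HasIIDEntries (μ : Measure ℝ) (P : Measure Ω)
    (Ψ : Ω → Fin N → Matrix (Fin n) (Fin m) ℝ) : Prop :=
  iIndepFun (fun (q : Fin N × Fin n × Fin m) (ω : Ω) => Ψ ω q.1 q.2.1 q.2.2) P ∧
    ∀ (j : Fin N) (i : Fin n) (l : Fin m), HasLaw (fun ω => Ψ ω j i l) μ P

/-- The distribution of a symmetric Bernoulli variable: `+1` or `-1` with equal probability. -/
noncomputable def signMeasure : Measure ℝ :=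
  bernoulliMeasure 1 (-1) ⟨1 / 2, by norm_num, by norm_num⟩

/-- The Gaussian ensemble: independent standard normal entries. -/
def IsGaussianEnsemble (P : Measure Ω) (Ψ : Ω → Fin N → Matrix (Fin n) (Fin m) ℝ) : Prop :=
  HasIIDEntries (gaussianReal 0 1) P Ψ

/-- The Bernoulli ensemble: independent `±1` entries with equal probabilities. -/
def IsBernoulliEnsemble (P : Measure Ω) (Ψ : Ω → Fin N → Matrix (Fin n) (Fin m) ℝ) : Prop :=
  HasIIDEntries signMeasure P Ψ

end Random

end SparseMatrixIdentification

/-! Put `A = dictionaryMatrix Ψ h`. Basis Pursuit recovers every `k`-sparse vector as soon as each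
non-zero kernel vector of `A` has less `ℓ₁`-mass on any `k` indices than on the others (the null
space property, `basisPursuitRecoversAll_of_nullSpaceProperty`).

This follows from a restricted isometry property in which the image is measured in `ℓ₁`: `α‖x‖₂ ≤
‖Ax‖₁ ≤ β‖x‖₂` for `(D+1)k`-sparse `x`. The ratio `β/α` need not be near 1; it suffices that `β² <
Dα²` (`sum_norm_lt_sum_compl_norm`).

For fixed real `x`, the coordinates of `Ax` are independent and, divided by `‖x‖₂‖h‖₂`, are
sub-Gaussian with unit variance in both ensembles. Chernoff bounds for the sum of their absolute
values give the two-sided estimate outside an event of probability `2 exp(-n/400)`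
(`HasIIDEntries.measureReal_measurementMap_notMem_le`).

A union bound makes this uniform. Up to scaling, integer vectors of `ℓ₁`-norm at most `qs` form a
net for all `s`-sparse vectors, whatever their supports (`exists_lattice_approximation`,
`hasSparseBounds_of_lattice`), and a generating function counts them (`card_latticeBall_le`). The
hypothesis on `k` makes the count beat the tail (`card_latticeBall_mul_le`). The complex case
reduces to real and imaginary parts. -/

namespace SparseMatrixIdentification

/-! ### Sparse norm bounds imply the null space property. -/

section SparseBounds

variable {𝕜 ι F : Type*} [RCLike 𝕜] [Fintype ι] [NormedAddCommGroup F] [NormedSpace 𝕜 F]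

/-- The Euclidean norm of a coefficient vector. -/
noncomputable def l2norm (x : ι → 𝕜) : ℝ := ‖(WithLp.toLp 2 x : EuclideanSpace 𝕜 ι)‖

lemma l2norm_nonneg (x : ι → 𝕜) : 0 ≤ l2norm x := norm_nonneg _

lemma l2norm_sq (x : ι → 𝕜) : l2norm x ^ 2 = ∑ j, ‖x j‖ ^ 2 := by
  simp [l2norm, EuclideanSpace.norm_sq_eq]

lemma l2norm_eq_zero {x : ι → 𝕜} : l2norm x = 0 ↔ x = 0 := by
  simp [l2norm]

lemma l2norm_le_l2norm {𝕜' : Type*} [RCLike 𝕜'] {x : ι → 𝕜} {y : ι → 𝕜'}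
    (h : ∀ j, ‖x j‖ ≤ ‖y j‖) : l2norm x ≤ l2norm y := by
  refine le_of_sq_le_sq ?_ (l2norm_nonneg y)
  rw [l2norm_sq, l2norm_sq]
  exact Finset.sum_le_sum fun j _ => by gcongr; exact h j

lemma l2norm_le_sqrt_card_mul {S : Finset ι} {M : ℕ} (hS : S.card ≤ M) {x : ι → 𝕜} {a : ℝ}
    (ha : 0 ≤ a) (hx : ∀ j ∉ S, x j = 0) (hxa : ∀ j ∈ S, ‖x j‖ ≤ a) :
    l2norm x ≤ √M * a := by
  refine le_of_sq_le_sq ?_ (by positivity)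
  rw [l2norm_sq, mul_pow, Real.sq_sqrt (by positivity)]
  calc ∑ j, ‖x j‖ ^ 2 = ∑ j ∈ S, ‖x j‖ ^ 2 := by
        symm
        apply Finset.sum_subset (Finset.subset_univ S)
        intro j _ hj
        simp [hx j hj]
    _ ≤ ∑ _j ∈ S, a ^ 2 := Finset.sum_le_sum fun j hj => by gcongr; exact hxa j hj
    _ = S.card * a ^ 2 := by simp
    _ ≤ M * a ^ 2 := by gcongr

lemma sum_norm_le_sqrt_card_mul_l2norm {S : Finset ι} {k : ℕ} (hS : S.card ≤ k) (x : ι → 𝕜) :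
    ∑ j ∈ S, ‖x j‖ ≤ √k * l2norm x := by
  refine le_of_sq_le_sq ?_ (mul_nonneg (Real.sqrt_nonneg _) (l2norm_nonneg _))
  rw [mul_pow, Real.sq_sqrt (by positivity), l2norm_sq]
  calc (∑ j ∈ S, ‖x j‖) ^ 2 ≤ S.card * ∑ j ∈ S, ‖x j‖ ^ 2 := sq_sum_le_card_mul_sum_sq
    _ ≤ k * ∑ j, ‖x j‖ ^ 2 := by
        gcongr
        · exact Finset.subset_univ S

/-- The linear map `T` distorts the Euclidean norm of `s`-sparse vectors at most by the
factors `α` and `β`. -/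
def HasSparseBounds (T : (ι → 𝕜) →ₗ[𝕜] F) (s : ℕ) (α β : ℝ) : Prop :=
  ∀ S : Finset ι, S.card ≤ s → ∀ x : ι → 𝕜, (∀ j ∉ S, x j = 0) →
    α * l2norm x ≤ ‖T x‖ ∧ ‖T x‖ ≤ β * l2norm x

lemma exists_subset_card_eq_forall_le {κ : Type*} [DecidableEq κ] (f : κ → ℝ) (T : Finset κ) :
    ∀ M ≤ T.card, ∃ U ⊆ T, U.card = M ∧ ∀ i ∈ U, ∀ j ∈ T \ U, f j ≤ f i := by
  intro M
  induction M with
  | zero => exact fun _ => ⟨∅, by simp⟩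
  | succ M ih =>
    intro hM
    obtain ⟨U, hUT, hU, hf⟩ := ih (by omega)
    have hne : (T \ U).Nonempty := by
      rw [← Finset.card_pos, Finset.card_sdiff_of_subset hUT]
      omega
    obtain ⟨m, hm, hmax⟩ := (T \ U).exists_max_image f hne
    have hm' := Finset.mem_sdiff.1 hm
    refine ⟨insert m U, Finset.insert_subset hm'.1 hUT, ?_, ?_⟩
    · rw [Finset.card_insert_of_notMem hm'.2, hU]
    · intro i hi j hj
      rw [Finset.mem_sdiff, Finset.mem_insert, not_or] at hj
      have hjU : j ∈ T \ U := Finset.mem_sdiff.2 ⟨hj.1, hj.2.2⟩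
      rcases Finset.mem_insert.1 hi with rfl | hi
      · exact hmax j hjU
      · exact hf i hi j hjU

/-- Cut `A` into blocks of `M` indices in decreasing order of `‖w j‖`. Each block has `ℓ₂`-norm at
most `√M` times its largest entry, hence at most the `ℓ₁`-norm of the preceding block divided by
`√M`. The number `a` stands for the entry bound inherited from that preceding block. -/
lemma norm_map_indicator_le {T : (ι → 𝕜) →ₗ[𝕜] F} {M : ℕ} {α β : ℝ}
    (hT : HasSparseBounds T M α β) (hM : 0 < M) (hβ : 0 ≤ β) (w : ι → 𝕜) (A : Finset ι) :
    ∀ a : ℝ, 0 ≤ a → (∀ j ∈ A, ‖w j‖ ≤ a) →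
      ‖T ((A : Set ι).indicator w)‖ ≤ β * (√M * a + (∑ j ∈ A, ‖w j‖) / √M) := by
  classical
  induction A using Finset.strongInduction with
  | H A ih =>
    intro a ha hwa
    have hM' : (0 : ℝ) < √M := by positivity
    have hsmall : ∀ U : Finset ι, U.card ≤ M → U ⊆ A →
        ‖T ((U : Set ι).indicator w)‖ ≤ β * (√M * a) := fun U hU hUA => by
      have hsupp : ∀ j ∉ U, (U : Set ι).indicator w j = 0 := fun j hj => by simp [hj]
      refine (hT U hU _ hsupp).2.trans ?_
      gcongr
      refine l2norm_le_sqrt_card_mul hU ha hsupp fun j hj => ?_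
      simpa [hj] using hwa j (hUA hj)
    rcases le_total A.card M with hA | hA
    · refine (hsmall A hA subset_rfl).trans ?_
      gcongr
      have : 0 ≤ (∑ j ∈ A, ‖w j‖) / √M := by positivity
      linarith
    · obtain ⟨U, hUA, hU, hf⟩ := exists_subset_card_eq_forall_le (fun j => ‖w j‖) A M hA
      have hUne : U.Nonempty := by rw [← Finset.card_pos]; omega
      obtain ⟨m, hm, hmin⟩ := U.exists_min_image (fun j => ‖w j‖) hUne
      have h1 := hsmall U hU.le hUA
      have h2 := ih (A \ U) (Finset.sdiff_ssubset hUA hUne) ‖w m‖ (norm_nonneg _)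
        (fun j hj => hf m hm j hj)
      have h3 : M * ‖w m‖ ≤ ∑ j ∈ U, ‖w j‖ := by
        rw [← hU, ← nsmul_eq_mul]
        exact Finset.card_nsmul_le_sum _ _ _ hmin
      have h4 : √M * ‖w m‖ ≤ (∑ j ∈ U, ‖w j‖) / √M := by
        rw [le_div_iff₀ hM']
        calc √M * ‖w m‖ * √M = (√M * √M) * ‖w m‖ := by ring
          _ = M * ‖w m‖ := by rw [Real.mul_self_sqrt (by positivity)]
          _ ≤ _ := h3
      have h5 : (A : Set ι).indicator w
          = (U : Set ι).indicator w + ((A \ U : Finset ι) : Set ι).indicator w := by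
        have hdisj : Disjoint (U : Set ι) ((A \ U : Finset ι) : Set ι) :=
          Finset.disjoint_coe.2 Finset.disjoint_sdiff
        refine Eq.trans ?_ (Set.indicator_union_of_disjoint hdisj w)
        rw [← Finset.coe_union, Finset.union_sdiff_of_subset hUA]
      rw [h5, map_add]
      refine (norm_add_le _ _).trans ((add_le_add h1 h2).trans ?_)
      rw [← mul_add, ← Finset.sum_sdiff hUA]
      gcongr
      rw [add_div]
      linarith

/-- Let `U` hold the `D * k` largest entries of `w` off `S`. Since `T w = 0`, the parts of `w` on
and off `S ∪ U` have images of equal norm. The lower bound on the first and the block estimate on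
the second give `‖w_S‖₁ ≤ β / (α√D) * ‖w_{Sᶜ}‖₁`. -/
theorem sum_norm_lt_sum_compl_norm [DecidableEq ι] {T : (ι → 𝕜) →ₗ[𝕜] F} {k D : ℕ} {α β : ℝ}
    (hT : HasSparseBounds T ((D + 1) * k) α β) (hk : 0 < k) (hα : 0 < α) (hβ : 0 < β)
    (hD : β ^ 2 < D * α ^ 2) {w : ι → 𝕜} (hw : T w = 0) (hw0 : w ≠ 0)
    {S : Finset ι} (hS : S.card ≤ k) : ∑ j ∈ S, ‖w j‖ < ∑ j ∈ Sᶜ, ‖w j‖ := by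
  have hDpos : 0 < D := by
    rcases Nat.eq_zero_or_pos D with rfl | h
    · exact absurd hD (by push_cast; nlinarith [sq_nonneg β])
    · exact h
  have hker : ∀ U : Finset ι, U.card ≤ (D + 1) * k → ¬ ∀ j ∉ U, w j = 0 := fun U hU hsupp => by
    have := (hT U hU w hsupp).1
    rw [hw, norm_zero] at this
    exact hw0 (l2norm_eq_zero.1 (le_antisymm (by nlinarith) (l2norm_nonneg w)))
  have hM : 0 < D * k := Nat.mul_pos hDpos hk
  -- Otherwise `w` itself is `(D + 1) * k`-sparse, and the lower bound forces `w = 0`.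
  have hcard : D * k ≤ Sᶜ.card := by
    by_contra hlt
    refine hker Finset.univ ?_ (by simp)
    rw [← Finset.union_compl S]
    refine (Finset.card_union_le _ _).trans ?_
    rw [add_mul]
    omega
  obtain ⟨U, hUS, hU, hf⟩ := exists_subset_card_eq_forall_le (fun j => ‖w j‖) Sᶜ (D * k) hcard
  have hUne : U.Nonempty := by rw [← Finset.card_pos]; omega
  obtain ⟨m, hm, hmin⟩ := U.exists_min_image (fun j => ‖w j‖) hUne
  have hMr : (0 : ℝ) < √(D * k : ℕ) := by positivity
  have h3 : (D * k : ℕ) * ‖w m‖ ≤ ∑ j ∈ U, ‖w j‖ := by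
    rw [← hU, ← nsmul_eq_mul]
    exact Finset.card_nsmul_le_sum _ _ _ hmin
  have h4 : √(D * k : ℕ) * ‖w m‖ ≤ (∑ j ∈ U, ‖w j‖) / √(D * k : ℕ) := by
    rw [le_div_iff₀ hMr]
    calc √(D * k : ℕ) * ‖w m‖ * √(D * k : ℕ) = (√(D * k : ℕ) * √(D * k : ℕ)) * ‖w m‖ := by ring
      _ = (D * k : ℕ) * ‖w m‖ := by rw [Real.mul_self_sqrt (by positivity)]
      _ ≤ _ := h3
  have hT' : HasSparseBounds T (D * k) α β := fun V hV =>
    hT V (hV.trans (Nat.mul_le_mul_right k (Nat.le_succ D)))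
  have h2 := norm_map_indicator_le hT' hM hβ.le w (Sᶜ \ U) ‖w m‖ (norm_nonneg _)
        (fun j hj => hf m hm j hj)
  have hsum : ∑ j ∈ Sᶜ, ‖w j‖ = ∑ j ∈ Sᶜ \ U, ‖w j‖ + ∑ j ∈ U, ‖w j‖ :=
    (Finset.sum_sdiff hUS).symm
  have htail : ‖T (((Sᶜ \ U : Finset ι) : Set ι).indicator w)‖
      ≤ β * ((∑ j ∈ Sᶜ, ‖w j‖) / √(D * k : ℕ)) := by
    refine h2.trans ?_
    gcongr
    rw [hsum, add_div]
    linarith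
  have hcompl : (Sᶜ \ U) = (S ∪ U)ᶜ := by
    ext j; simp
  have hsplit : w = ((S ∪ U : Finset ι) : Set ι).indicator w
      + ((Sᶜ \ U : Finset ι) : Set ι).indicator w := by
    rw [hcompl, Finset.coe_compl, Set.indicator_self_add_compl]
  have hnorm : ‖T (((S ∪ U : Finset ι) : Set ι).indicator w)‖
      = ‖T (((Sᶜ \ U : Finset ι) : Set ι).indicator w)‖ := by
    have : T (((S ∪ U : Finset ι) : Set ι).indicator w)
        = - T (((Sᶜ \ U : Finset ι) : Set ι).indicator w) := by
      rw [eq_neg_iff_add_eq_zero, ← map_add, ← hsplit, hw]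
    rw [this, norm_neg]
  have hSU : (S ∪ U).card ≤ (D + 1) * k := by
    refine (Finset.card_union_le _ _).trans ?_
    rw [add_mul]
    omega
  have hlow := (hT (S ∪ U) hSU (((S ∪ U : Finset ι) : Set ι).indicator w)
    (fun j hj => Set.indicator_of_notMem (by simpa using hj) w)).1
  rw [hnorm] at hlow
  have hhead : ∑ j ∈ S, ‖w j‖ ≤ √k * l2norm (((S ∪ U : Finset ι) : Set ι).indicator w) := by
    refine le_of_eq_of_le ?_ (sum_norm_le_sqrt_card_mul_l2norm hS _)
    exact Finset.sum_congr rfl fun j hj => by simp [hj]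
  have hpos : 0 < ∑ j ∈ Sᶜ, ‖w j‖ := by
    by_contra hle
    have h0 : ∑ j ∈ Sᶜ, ‖w j‖ = 0 :=
      le_antisymm (not_lt.1 hle) (Finset.sum_nonneg fun _ _ => norm_nonneg _)
    rw [Finset.sum_eq_zero_iff_of_nonneg fun _ _ => norm_nonneg _] at h0
    exact hker S (hS.trans (Nat.le_mul_of_pos_left k (Nat.succ_pos D)))
      fun j hj => norm_eq_zero.1 (h0 j (Finset.mem_compl.2 hj))
  have hk' : (0 : ℝ) < √k := by positivity
  have hβD : β < √D * α := by
    refine lt_of_pow_lt_pow_left₀ 2 (by positivity) ?_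
    rwa [mul_pow, Real.sq_sqrt (by positivity)]
  have hfin : α * ∑ j ∈ S, ‖w j‖ < α * ∑ j ∈ Sᶜ, ‖w j‖ := by
    calc α * ∑ j ∈ S, ‖w j‖
        ≤ √k * (α * l2norm (((S ∪ U : Finset ι) : Set ι).indicator w)) := by
          rw [mul_left_comm]; gcongr
      _ ≤ √k * (β * ((∑ j ∈ Sᶜ, ‖w j‖) / √(D * k : ℕ))) := by
          exact mul_le_mul_of_nonneg_left (hlow.trans htail) hk'.le
      _ = β / √D * ∑ j ∈ Sᶜ, ‖w j‖ := by
          rw [Nat.cast_mul, Real.sqrt_mul (by positivity)]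
          field_simp
      _ < α * ∑ j ∈ Sᶜ, ‖w j‖ := by
          refine mul_lt_mul_of_pos_right ?_ hpos
          rw [div_lt_iff₀ (by positivity)]
          linarith
  exact lt_of_mul_lt_mul_left hfin hα.le

end SparseBounds

/-! ### The null space property implies recovery. -/

section Recovery

variable {𝕜 : Type*} [RCLike 𝕜] {n m N : ℕ}

lemma dictionaryMatrix_mulVec (Ψ : Fin N → Matrix (Fin n) (Fin m) 𝕜) (h : Fin m → 𝕜)
    (x : Fin N → 𝕜) :
    (dictionaryMatrix Ψ h).mulVec x = (∑ j, x j • Ψ j).mulVec h := by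
  rw [Matrix.sum_mulVec]
  ext i
  simp [Matrix.mulVec, dictionaryMatrix, dotProduct, Finset.sum_apply, Finset.mul_sum,
    mul_comm, mul_left_comm]

theorem basisPursuitRecoversAll_of_nullSpaceProperty {Ψ : Fin N → Matrix (Fin n) (Fin m) 𝕜}
    {h : Fin m → 𝕜} {k : ℕ}
    (hnsp : ∀ w : Fin N → 𝕜, (dictionaryMatrix Ψ h).mulVec w = 0 → w ≠ 0 →
      ∀ S : Finset (Fin N), S.card ≤ k → ∑ j ∈ S, ‖w j‖ < ∑ j ∈ Sᶜ, ‖w j‖) :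
    BasisPursuitRecoversAll Ψ h k := by
  classical
  rintro Γ x ⟨rfl, hx⟩ x'
  rw [← dictionaryMatrix_mulVec]
  set S : Finset (Fin N) := {j | x j ≠ 0} with hS
  have hScard : S.card ≤ k := by
    rw [← hx, l0norm, ← Set.ncard_coe_finset]
    simp [hS]
  have hlt : ∀ y : Fin N → 𝕜, (dictionaryMatrix Ψ h).mulVec y = (dictionaryMatrix Ψ h).mulVec x →
      y ≠ x → l1norm x < l1norm y := fun y hy hne => by
    have hw := hnsp (y - x) (by rw [Matrix.mulVec_sub, hy, sub_self]) (sub_ne_zero.2 hne) S hScard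
    have hcompl : ∑ j ∈ Sᶜ, ‖(y - x) j‖ = ∑ j ∈ Sᶜ, ‖y j‖ := by
      refine Finset.sum_congr rfl fun j hj => ?_
      have : x j = 0 := by simpa [hS] using hj
      simp [this]
    have hxsum : l1norm x = ∑ j ∈ S, ‖x j‖ := by
      symm
      refine Finset.sum_subset (Finset.subset_univ S) fun j _ hj => ?_
      have : x j = 0 := by simpa [hS] using hj
      simp [this]
    have htri : ∑ j ∈ S, ‖x j‖ ≤ ∑ j ∈ S, ‖y j‖ + ∑ j ∈ S, ‖(y - x) j‖ := by
      rw [← Finset.sum_add_distrib]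
      refine Finset.sum_le_sum fun j _ => ?_
      have := norm_sub_le (y j) ((y - x) j)
      simpa using this
    have hysum : l1norm y = ∑ j ∈ S, ‖y j‖ + ∑ j ∈ Sᶜ, ‖y j‖ :=
      (Finset.sum_add_sum_compl S _).symm
    rw [hcompl] at hw
    linarith
  constructor
  · rintro ⟨hfeas, hmin⟩
    by_contra hne
    exact (hlt x' hfeas hne).not_ge (hmin x rfl)
  · rintro rfl
    refine ⟨rfl, fun y hy => ?_⟩
    by_cases hne : y = x'
    · rw [hne]
    · exact (hlt y hy hne).le

end Recovery

/-! ### Transfer of the bounds from real to complex vectors. -/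

section MeasurementMap

variable {ι : Type*} [Fintype ι] {n : ℕ}

/-- Multiplication by a real matrix, with the `ℓ₁`-norm on the target space. -/
noncomputable def measurementMap (𝕜 : Type*) [RCLike 𝕜] (A : Matrix (Fin n) ι ℝ) :
    (ι → 𝕜) →ₗ[𝕜] PiLp 1 (fun _ : Fin n => 𝕜) :=
  (WithLp.linearEquiv 1 𝕜 (Fin n → 𝕜)).symm.toLinearMap ∘ₗ
    (A.map (algebraMap ℝ 𝕜)).mulVecLin

lemma norm_measurementMap (𝕜 : Type*) [RCLike 𝕜] (A : Matrix (Fin n) ι ℝ) (x : ι → 𝕜) :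
    ‖measurementMap 𝕜 A x‖ = ∑ i, ‖(A.map (algebraMap ℝ 𝕜)).mulVec x i‖ := by
  rw [PiLp.norm_eq_of_L1]
  rfl

lemma norm_measurementMap_real (A : Matrix (Fin n) ι ℝ) (x : ι → ℝ) :
    ‖measurementMap ℝ A x‖ = ∑ i, |A.mulVec x i| := by
  rw [norm_measurementMap]
  rfl

lemma measurementMap_eq_zero {𝕜 : Type*} [RCLike 𝕜] {A : Matrix (Fin n) ι ℝ} {x : ι → 𝕜}
    (h : (A.map (algebraMap ℝ 𝕜)).mulVec x = 0) : measurementMap 𝕜 A x = 0 := by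
  rw [← norm_eq_zero, norm_measurementMap, h]
  simp

lemma l2norm_le_add_re_im {𝕜 : Type*} [RCLike 𝕜] (x : ι → 𝕜) :
    l2norm x ≤ l2norm (fun j => RCLike.re (x j)) + l2norm (fun j => RCLike.im (x j)) := by
  refine le_of_sq_le_sq ?_ (add_nonneg (l2norm_nonneg _) (l2norm_nonneg _))
  have h1 := l2norm_sq (fun j => RCLike.re (x j))
  have h2 := l2norm_sq (fun j => RCLike.im (x j))
  have h3 : l2norm x ^ 2 = l2norm (fun j => RCLike.re (x j)) ^ 2
      + l2norm (fun j => RCLike.im (x j)) ^ 2 := by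
    rw [l2norm_sq, h1, h2, ← Finset.sum_add_distrib]
    refine Finset.sum_congr rfl fun j _ => ?_
    rw [RCLike.norm_sq_eq_def]
    simp [sq_abs]
    ring
  nlinarith [l2norm_nonneg (fun j => RCLike.re (x j)), l2norm_nonneg (fun j => RCLike.im (x j))]

/-- A real matrix acts separately on real and imaginary parts, which inherit the support of `x`.
Each factor 2 comes from adding the estimates for the two parts. -/
theorem hasSparseBounds_measurementMap {𝕜 : Type*} [RCLike 𝕜] {A : Matrix (Fin n) ι ℝ} {s : ℕ}
    {α β : ℝ} (h : HasSparseBounds (measurementMap ℝ A) s α β) (hα : 0 ≤ α) (hβ : 0 ≤ β) :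
    HasSparseBounds (measurementMap 𝕜 A) s (α / 2) (2 * β) := by
  intro S hS x hx
  obtain ⟨hr1, hr2⟩ := h S hS (fun j => RCLike.re (x j)) (fun j hj => by simp [hx j hj])
  obtain ⟨hi1, hi2⟩ := h S hS (fun j => RCLike.im (x j)) (fun j hj => by simp [hx j hj])
  have hre : ∀ i, RCLike.re ((A.map (algebraMap ℝ 𝕜)).mulVec x i)
      = A.mulVec (fun j => RCLike.re (x j)) i := fun i => by
    simp [Matrix.mulVec, dotProduct, map_sum]
  have him : ∀ i, RCLike.im ((A.map (algebraMap ℝ 𝕜)).mulVec x i)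
      = A.mulVec (fun j => RCLike.im (x j)) i := fun i => by
    simp [Matrix.mulVec, dotProduct, map_sum]
  have hup : ‖measurementMap 𝕜 A x‖
      ≤ ‖measurementMap ℝ A (fun j => RCLike.re (x j))‖
        + ‖measurementMap ℝ A (fun j => RCLike.im (x j))‖ := by
    rw [norm_measurementMap, norm_measurementMap_real, norm_measurementMap_real,
      ← Finset.sum_add_distrib]
    refine Finset.sum_le_sum fun i _ => ?_
    rw [← hre, ← him]
    refine le_of_sq_le_sq ?_ (by positivity)
    rw [RCLike.norm_sq_eq_def, add_sq, sq_abs, sq_abs]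
    nlinarith [mul_nonneg (abs_nonneg (RCLike.re ((A.map (algebraMap ℝ 𝕜)).mulVec x i)))
      (abs_nonneg (RCLike.im ((A.map (algebraMap ℝ 𝕜)).mulVec x i)))]
  have hlo1 : ‖measurementMap ℝ A (fun j => RCLike.re (x j))‖
      ≤ ‖measurementMap 𝕜 A x‖ := by
    rw [norm_measurementMap_real, norm_measurementMap]
    refine Finset.sum_le_sum fun i _ => ?_
    rw [← hre]
    exact RCLike.abs_re_le_norm _
  have hlo2 : ‖measurementMap ℝ A (fun j => RCLike.im (x j))‖
      ≤ ‖measurementMap 𝕜 A x‖ := by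
    rw [norm_measurementMap_real, norm_measurementMap]
    refine Finset.sum_le_sum fun i _ => ?_
    rw [← him]
    exact RCLike.abs_im_le_norm _
  have hre' : l2norm (fun j => RCLike.re (x j)) ≤ l2norm x :=
    l2norm_le_l2norm fun j => by simpa using RCLike.abs_re_le_norm (x j)
  have him' : l2norm (fun j => RCLike.im (x j)) ≤ l2norm x :=
    l2norm_le_l2norm fun j => by simpa using RCLike.abs_im_le_norm (x j)
  have htri := mul_le_mul_of_nonneg_left (l2norm_le_add_re_im x) hα
  have hb1 := mul_le_mul_of_nonneg_left hre' hβ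
  have hb2 := mul_le_mul_of_nonneg_left him' hβ
  constructor <;> linarith

end MeasurementMap

/-! ### Integer vectors as a net for sparse vectors. -/

section Net

variable {ι F : Type*} [Fintype ι] [NormedAddCommGroup F] [NormedSpace ℝ F]

lemma exists_int_abs_le_abs (t : ℝ) : ∃ z : ℤ, |(z : ℝ)| ≤ |t| ∧ |t - z| ≤ 1 := by
  rcases le_total 0 t with ht | ht
  · refine ⟨⌊t⌋, ?_, ?_⟩
    · rw [abs_of_nonneg ht, abs_of_nonneg (by exact_mod_cast Int.floor_nonneg.2 ht)]
      exact Int.floor_le t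
    · rw [abs_le]
      constructor <;> linarith [Int.floor_le t, Int.lt_floor_add_one t]
  · refine ⟨⌈t⌉, ?_, ?_⟩
    · have : (⌈t⌉ : ℝ) ≤ 0 := by exact_mod_cast Int.ceil_le.2 (by simpa using ht)
      rw [abs_of_nonpos ht, abs_of_nonpos this]
      linarith [Int.le_ceil t]
    · rw [abs_le]
      constructor <;> linarith [Int.le_ceil t, Int.ceil_lt_add_one t]

lemma l2norm_smul (c : ℝ) (x : ι → ℝ) : l2norm (c • x) = |c| * l2norm x := by
  rw [l2norm, l2norm, WithLp.toLp_smul, norm_smul, Real.norm_eq_abs]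

lemma l2norm_add_le (x y : ι → ℝ) : l2norm (x + y) ≤ l2norm x + l2norm y := by
  rw [l2norm, l2norm, l2norm, WithLp.toLp_add]
  exact norm_add_le _ _

/-- Round `x / c` towards zero. The step `c = ‖x‖₂ / (q√s)` makes the error at most `√s * c = ‖x‖₂ /
q`. As rounding does not increase moduli, `c‖z‖₁ ≤ ‖x‖₁ ≤ √s‖x‖₂ = c q s`. -/
lemma exists_lattice_approximation {q s : ℕ} (hq : 0 < q) {S : Finset ι}
    (hS : S.card ≤ s) {x : ι → ℝ} (hx : ∀ j ∉ S, x j = 0) :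
    ∃ (c : ℝ) (z : ι → ℤ), ∑ j, |z j| ≤ (q * s : ℕ) ∧ (∀ j ∉ S, z j = 0) ∧
      l2norm (c • fun j => (z j : ℝ)) ≤ l2norm x ∧
      l2norm (x - c • fun j => (z j : ℝ)) ≤ l2norm x / q := by
  rcases eq_or_ne x 0 with rfl | hx0
  · refine ⟨0, 0, by simp; positivity, by simp, by simp, ?_⟩
    simp only [zero_smul, sub_zero]
    rw [l2norm_eq_zero.2 rfl]
    simp
  have hl : 0 < l2norm x := lt_of_le_of_ne (l2norm_nonneg x) fun h => hx0 (l2norm_eq_zero.1 h.symm)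
  have hs : 0 < s := by
    rcases Nat.eq_zero_or_pos s with rfl | h
    · refine absurd (funext fun j => hx j ?_) hx0
      rw [Finset.card_eq_zero.1 (Nat.le_zero.1 hS)]
      simp
    · exact h
  have hs' : (0 : ℝ) < √s := by positivity
  have hq' : (0 : ℝ) < q := by positivity
  set c : ℝ := l2norm x / (q * √s) with hc
  have hcpos : 0 < c := by positivity
  choose z hz1 hz2 using fun j => exists_int_abs_le_abs (x j / c)
  have hz1' : ∀ j, c * |(z j : ℝ)| ≤ |x j| := fun j => by
    have := hz1 j
    rw [abs_div, abs_of_pos hcpos, le_div_iff₀ hcpos] at this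
    linarith
  have hzS : ∀ j ∉ S, z j = 0 := fun j hj => by
    have := hz1 j
    rw [hx j hj] at this
    simpa using this
  refine ⟨c, z, ?_, hzS, ?_, ?_⟩
  · have hsum : c * ∑ j, |(z j : ℝ)| ≤ √s * l2norm x := by
      refine le_trans ?_ (sum_norm_le_sqrt_card_mul_l2norm hS x)
      rw [Finset.mul_sum, ← Finset.sum_subset (Finset.subset_univ S)]
      · exact Finset.sum_le_sum fun j _ => hz1' j
      · intro j _ hj
        simp [hzS j hj]
    have hval : √s * l2norm x = c * (q * s) := by
      rw [hc]
      field_simp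
      rw [Real.sq_sqrt (by positivity)]
    rw [hval] at hsum
    have := le_of_mul_le_mul_left hsum hcpos
    exact_mod_cast this
  · refine l2norm_le_l2norm fun j => ?_
    simp only [Pi.smul_apply, smul_eq_mul, norm_mul, Real.norm_eq_abs, abs_of_pos hcpos]
    exact hz1' j
  · have hr : l2norm (x - c • fun j => (z j : ℝ)) ≤ √s * c := by
      refine l2norm_le_sqrt_card_mul hS hcpos.le ?_ ?_
      · intro j hj
        simp [hx j hj, hzS j hj]
      · intro j _
        have h1 : (x - c • fun j => (z j : ℝ)) j = c * (x j / c - z j) := by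
          simp only [Pi.sub_apply, Pi.smul_apply, smul_eq_mul]
          field_simp
        rw [h1, norm_mul, Real.norm_eq_abs, Real.norm_eq_abs, abs_of_pos hcpos]
        exact mul_le_of_le_one_right hcpos.le (hz2 j)
    refine hr.trans_eq ?_
    rw [hc]
    field_simp

/-- Upper bound: start from any operator bound `C` and approximate the remainder again. Each round
at least halves the remainder, so the contribution of `C` tends to 0 and a geometric series leaves
`2 * β`. Lower bound: one approximation `y` suffices, with the upper bound applied to `x - y`. -/
theorem hasSparseBounds_of_lattice {T : (ι → ℝ) →ₗ[ℝ] F} {q s : ℕ} {α β : ℝ} (hα : 0 ≤ α)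
    (hβ : 0 ≤ β) (hq : 2 ≤ q) (hqαβ : (α + 2 * β) / q ≤ α / 2)
    (h : ∀ z : ι → ℤ, ∑ j, |z j| ≤ (q * s : ℕ) →
      α * l2norm (fun j => (z j : ℝ)) ≤ ‖T fun j => (z j : ℝ)‖ ∧
      ‖T fun j => (z j : ℝ)‖ ≤ β * l2norm (fun j => (z j : ℝ))) :
    HasSparseBounds T s (α / 2) (2 * β) := by
  intro S hS
  have hq2 : (2 : ℝ) ≤ q := by exact_mod_cast hq
  obtain ⟨C, hC0, hC⟩ : ∃ C : ℝ, 0 ≤ C ∧ ∀ x, ‖T x‖ ≤ C * l2norm x := by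
    let L := (T ∘ₗ (WithLp.linearEquiv 2 ℝ (ι → ℝ)).toLinearMap :
      EuclideanSpace ℝ ι →ₗ[ℝ] F).toContinuousLinearMap
    exact ⟨‖L‖, norm_nonneg _, fun x => L.le_opNorm (WithLp.toLp 2 x)⟩
  have happrox : ∀ x : ι → ℝ, (∀ j ∉ S, x j = 0) → ∃ y : ι → ℝ, (∀ j ∉ S, y j = 0) ∧
      l2norm y ≤ l2norm x ∧ l2norm (x - y) ≤ l2norm x / q ∧
      α * l2norm y ≤ ‖T y‖ ∧ ‖T y‖ ≤ β * l2norm y := fun x hx => by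
    obtain ⟨c, z, hz, hzS, h1, h2⟩ := exists_lattice_approximation (by omega : 0 < q) hS hx
    refine ⟨_, fun j hj => by simp [hzS j hj], h1, h2, ?_⟩
    obtain ⟨h3, h4⟩ := h z hz
    rw [map_smul, norm_smul, l2norm_smul, Real.norm_eq_abs]
    constructor
    · rw [mul_left_comm]
      gcongr
    · rw [mul_left_comm]
      gcongr
  have hupper : ∀ (i : ℕ) (x : ι → ℝ), (∀ j ∉ S, x j = 0) →
      ‖T x‖ ≤ (2 * β + C * (1 / 2) ^ i) * l2norm x := by
    intro i
    induction i with
    | zero =>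
      intro x _
      refine (hC x).trans ?_
      have := l2norm_nonneg x
      gcongr
      simp
      linarith
    | succ i ih =>
      intro x hx
      obtain ⟨y, hy, h1, h2, -, h3⟩ := happrox x hx
      have h4 := ih (x - y) fun j hj => by simp [hx j hj, hy j hj]
      have h5 : l2norm (x - y) ≤ l2norm x / 2 :=
        h2.trans (div_le_div_of_nonneg_left (l2norm_nonneg x) (by norm_num) hq2)
      have h6 : ‖T x‖ ≤ ‖T y‖ + ‖T (x - y)‖ := by
        rw [map_sub]
        exact norm_le_insert' _ _
      have h7 : (0 : ℝ) ≤ 2 * β + C * (1 / 2) ^ i := by positivity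
      have h8 := mul_le_mul_of_nonneg_left h5 h7
      have h9 := mul_le_mul_of_nonneg_left h1 hβ
      rw [pow_succ]
      linarith
  have hupper' : ∀ x : ι → ℝ, (∀ j ∉ S, x j = 0) → ‖T x‖ ≤ 2 * β * l2norm x := fun x hx => by
    refine ge_of_tendsto' (f := fun i : ℕ => (2 * β + C * (1 / 2) ^ i) * l2norm x)
      (x := Filter.atTop) ?_ fun i => hupper i x hx
    have h1 := tendsto_pow_atTop_nhds_zero_of_lt_one (r := (1 / 2 : ℝ)) (by norm_num) (by norm_num)
    simpa using ((h1.const_mul C).const_add (2 * β)).mul_const (l2norm x)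
  intro x hx
  refine ⟨?_, hupper' x hx⟩
  obtain ⟨y, hy, h1, h2, h3, -⟩ := happrox x hx
  have h4 := hupper' (x - y) fun j hj => by simp [hx j hj, hy j hj]
  have h5 : ‖T y‖ ≤ ‖T x‖ + ‖T (x - y)‖ := by
    rw [map_sub, norm_sub_rev]
    exact norm_le_insert' _ _
  have h6 : l2norm x ≤ l2norm y + l2norm (x - y) := by
    simpa using l2norm_add_le y (x - y)
  have h7 := mul_le_mul_of_nonneg_left h6 hα
  have h8 := mul_le_mul_of_nonneg_left h2 (by positivity : 0 ≤ α + 2 * β)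
  have h9 := mul_le_mul_of_nonneg_right hqαβ (l2norm_nonneg x)
  have h10 : (α + 2 * β) * (l2norm x / q) = (α + 2 * β) / q * l2norm x := by ring
  linarith

end Net

/-! ### Counting integer points in an `ℓ₁`-ball. -/

section LatticeCount

/-- The subtracted term carries the induction: `2t^(R+1) ≤ 4t^(R+1) - 4t^(R+2)` because `t ≤ 1/2`.
-/
lemma sum_Icc_pow_natAbs_le {t : ℝ} (ht : 0 < t) (ht2 : t ≤ 1 / 2) (R : ℕ) :
    ∑ a ∈ Finset.Icc (-(R : ℤ)) R, t ^ a.natAbs ≤ 1 + 4 * t - 4 * t ^ (R + 1) := by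
  induction R with
  | zero => simp
  | succ R ih =>
    have h1 : Finset.Icc (-((R + 1 : ℕ) : ℤ)) (R + 1 : ℕ)
        = insert (-((R + 1 : ℕ) : ℤ)) (insert ((R + 1 : ℕ) : ℤ) (Finset.Icc (-(R : ℤ)) R)) := by
      ext a
      simp only [Finset.mem_Icc, Finset.mem_insert]
      push_cast
      omega
    rw [h1, Finset.sum_insert (by simp; omega), Finset.sum_insert (by simp), Int.natAbs_neg,
      Int.natAbs_natCast]
    have h2 : (0 : ℝ) < t ^ (R + 1) := by positivity
    have h3 := mul_le_mul_of_nonneg_left ht2 h2.le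
    rw [pow_succ t (R + 1)]
    linarith

/-- The integer vectors with `ℓ₁`-norm at most `R`. -/
noncomputable def latticeBall (ι : Type*) [Fintype ι] [DecidableEq ι] (R : ℕ) :
    Finset (ι → ℤ) :=
  (Fintype.piFinset fun _ => Finset.Icc (-(R : ℤ)) R).filter fun z => ∑ j, |z j| ≤ R

lemma mem_latticeBall {ι : Type*} [Fintype ι] [DecidableEq ι] {R : ℕ} {z : ι → ℤ} :
    z ∈ latticeBall ι R ↔ ∑ j, |z j| ≤ R := by
  simp only [latticeBall, Finset.mem_filter, Fintype.mem_piFinset, Finset.mem_Icc,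
    and_iff_right_iff_imp]
  intro h j
  rw [← abs_le]
  exact (Finset.single_le_sum (f := fun j => |z j|) (fun _ _ => abs_nonneg _)
    (Finset.mem_univ j)).trans h

/-- Give `z` the weight `t ^ ‖z‖₁`, which is at least `t ^ R` on the ball. The total weight over the
surrounding box factors over coordinates. -/
lemma card_latticeBall_le {ι : Type*} [Fintype ι] [DecidableEq ι] (R : ℕ) {t : ℝ} (ht : 0 < t)
    (ht2 : t ≤ 1 / 2) :
    ((latticeBall ι R).card : ℝ) ≤ (t ^ R)⁻¹ * Real.exp (4 * t * Fintype.card ι) := by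
  have h1 : ((latticeBall ι R).card : ℝ) * t ^ R ≤ ∑ z ∈ latticeBall ι R, ∏ j, t ^ (z j).natAbs := by
    rw [← nsmul_eq_mul]
    refine Finset.card_nsmul_le_sum _ _ _ fun z hz => ?_
    rw [Finset.prod_pow_eq_pow_sum]
    refine pow_le_pow_of_le_one ht.le (by linarith) ?_
    have := mem_latticeBall.1 hz
    zify
    exact this
  have h2 : ∑ z ∈ latticeBall ι R, ∏ j, t ^ (z j).natAbs
      ≤ ∑ z ∈ Fintype.piFinset fun _ : ι => Finset.Icc (-(R : ℤ)) R, ∏ j, t ^ (z j).natAbs :=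
    Finset.sum_le_sum_of_subset_of_nonneg (Finset.filter_subset _ _) fun _ _ _ => by positivity
  rw [← Finset.prod_univ_sum (fun _ : ι => Finset.Icc (-(R : ℤ)) R)
    (fun _ a => t ^ a.natAbs)] at h2
  have h3 : ∏ _j : ι, ∑ a ∈ Finset.Icc (-(R : ℤ)) R, t ^ a.natAbs
      ≤ ∏ _j : ι, Real.exp (4 * t) := by
    refine Finset.prod_le_prod (fun _ _ => by positivity) fun _ _ => ?_
    have h4 := sum_Icc_pow_natAbs_le ht ht2 R
    have h5 := Real.add_one_le_exp (4 * t)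
    have h6 : (0 : ℝ) < t ^ (R + 1) := by positivity
    linarith
  rw [Finset.prod_const (Real.exp _), Finset.card_univ, ← Real.exp_nat_mul] at h3
  rw [inv_mul_eq_div, le_div_iff₀ (by positivity)]
  calc _ ≤ _ := h1.trans (h2.trans h3)
    _ = _ := by ring_nf

end LatticeCount

/-! ### Concentration of `‖Ax‖₁` for a fixed vector. -/

section Concentration

variable {Ω : Type*} [MeasurableSpace Ω] {P : Measure Ω}

/-- A centred sub-Gaussian distribution with unit variance and unit variance proxy. -/
structure IsStandardSubgaussian (μ : Measure ℝ) : Prop where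
  hasSubgaussianMGF : HasSubgaussianMGF (fun x => x) 1 μ
  integral_eq_zero : ∫ x, x ∂μ = 0
  integral_sq_eq_one : ∫ x, x ^ 2 ∂μ = 1

lemma isStandardSubgaussian_gaussianReal : IsStandardSubgaussian (gaussianReal 0 1) where
  hasSubgaussianMGF :=
    { integrable_exp_mul := fun t => integrable_exp_mul_gaussianReal t
      mgf_le := fun t => by
        rw [mgf_fun_id_gaussianReal]
        simp }
  integral_eq_zero := by simp
  integral_sq_eq_one := by
    have h := variance_fun_id_gaussianReal (μ := 0) (v := 1)
    rw [variance_of_integral_eq_zero (by fun_prop) (by simp)] at h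
    simpa using h

lemma isStandardSubgaussian_signMeasure : IsStandardSubgaussian signMeasure where
  hasSubgaussianMGF :=
    { integrable_exp_mul := fun t => integrable_bernoulliMeasure _ _ _ _
      mgf_le := fun t => by
        rw [mgf, signMeasure, integral_bernoulliMeasure]
        refine le_trans (le_of_eq ?_) ((Real.cosh_le_exp_half_sq t).trans (by simp))
        rw [Real.cosh_eq]
        simp
        ring }
  integral_eq_zero := by
    rw [signMeasure, integral_bernoulliMeasure]
    norm_num
  integral_sq_eq_one := by
    rw [signMeasure, integral_bernoulliMeasure]
    norm_num

/-- Used to pass from independent entries to independent rows: the joint law is a product measure,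
and currying a product measure gives a product of products. -/
lemma iIndepFun_curry {ι κ : Type*} [Countable ι] [Countable κ] {X : ι × κ → Ω → ℝ}
    (hX : ∀ p, AEMeasurable (X p) P) (h : iIndepFun X P) :
    iIndepFun (fun i ω j => X (i, j) ω) P := by
  have hP := h.isProbabilityMeasure
  have hm : ∀ i, AEMeasurable (fun ω j => X (i, j) ω) P := fun i =>
    aemeasurable_pi_lambda _ fun j => hX (i, j)
  have hprob : ∀ i j, IsProbabilityMeasure (P.map (X (i, j))) := fun i j =>
    Measure.isProbabilityMeasure_map (hX (i, j))
  rw [iIndepFun_iff_map_fun_eq_infinitePi_map₀' hm]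
  have h1 := h.map_fun_eq_infinitePi_map₀' hX
  have h2 : ∀ i, P.map (fun ω j => X (i, j) ω) = Measure.infinitePi fun j => P.map (X (i, j)) :=
    fun i => (h.precomp (Prod.mk_right_injective i)).map_fun_eq_infinitePi_map₀' fun j => hX (i, j)
  simp_rw [h2]
  rw [← Measure.infinitePi_map_curry (fun i j => P.map (X (i, j)))]
  change _ = Measure.map _ (Measure.infinitePi fun p => P.map (X p))
  rw [← h1, AEMeasurable.map_map_of_aemeasurable (by fun_prop)
    (aemeasurable_pi_lambda _ hX)]
  rfl

lemma exp_abs_le_exp_add_exp_neg (y : ℝ) : Real.exp |y| ≤ Real.exp y + Real.exp (-y) := by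
  rcases abs_choice y with h | h <;> rw [h] <;> linarith [Real.exp_pos y, Real.exp_pos (-y)]

lemma pow_four_le (y : ℝ) : y ^ 4 ≤ 12 * (Real.exp y + Real.exp (-y)) := by
  have h := le_hasSum (Real.hasSum_cosh y) 2 fun i _ => by
    rw [pow_mul]
    positivity
  rw [Real.cosh_eq] at h
  norm_num [Nat.factorial] at h
  linarith

lemma exp_neg_le_quadratic {u : ℝ} (hu : 0 ≤ u) : Real.exp (-u) ≤ 1 - u + u ^ 2 / 2 := by
  have h1 := Real.quadratic_le_exp_of_nonneg hu
  rw [Real.exp_neg, inv_le_iff_one_le_mul₀ (Real.exp_pos u)]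
  have h2 : 0 ≤ 1 - u + u ^ 2 / 2 := by nlinarith [sq_nonneg (u - 1)]
  nlinarith [mul_le_mul_of_nonneg_left h1 h2, pow_nonneg hu 4]

/-- Prepares a bound on `E exp(-|Y|/10)` from `E Y² = 1`. Expand the exponential to second order,
bound `|y|` below by a quadratic minus a quartic, and absorb the quartic into `exp y + exp (-y)`. -/
lemma exp_neg_abs_div_le (y : ℝ) :
    Real.exp (-1 / 10 * |y|) ≤ 1 - y ^ 2 / 40 + 3 / 500 * (Real.exp y + Real.exp (-y)) := by
  have h1 := exp_neg_le_quadratic (u := |y| / 10) (by positivity)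
  have h2 := pow_four_le y
  have h3 : 3 / 10 * y ^ 2 - y ^ 4 / 200 ≤ |y| := by
    have h4 : 0 ≤ |y| * (1 - 3 / 10 * |y| + |y| ^ 3 / 200) := by
      refine mul_nonneg (abs_nonneg y) ?_
      -- The cubic in `|y|` has its minimum on the half-line at `√20`, close to `9/2`; the product
      -- in the hint has no quadratic term.
      nlinarith [mul_nonneg (sq_nonneg (|y| - 9 / 2)) (by positivity : 0 ≤ |y| + 9), abs_nonneg y]
    have h5 : |y| * (1 - 3 / 10 * |y| + |y| ^ 3 / 200)
        = |y| - 3 / 10 * |y| ^ 2 + (|y| ^ 2) ^ 2 / 200 := by ring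
    rw [h5, sq_abs] at h4
    nlinarith
  have h6 : -1 / 10 * |y| = -(|y| / 10) := by ring
  rw [div_pow, sq_abs] at h1
  rw [h6]
  linarith

lemma exp_half_le : Real.exp (1 / 2) ≤ 33 / 20 := by
  refine le_of_sq_le_sq ?_ (by norm_num)
  rw [← Real.exp_nat_mul]
  norm_num
  linarith [Real.exp_one_lt_d9]

lemma integrable_exp_add_exp_neg {Y : Ω → ℝ} (hY : HasSubgaussianMGF Y 1 P) :
    Integrable (fun ω => Real.exp (Y ω) + Real.exp (-Y ω)) P := by
  have h3 := hY.integrable_exp_mul 1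
  have h4 := hY.integrable_exp_mul (-1)
  simp only [one_mul, neg_one_mul] at h3 h4
  exact h3.add h4

lemma integral_exp_add_exp_neg_le {Y : Ω → ℝ} (hY : HasSubgaussianMGF Y 1 P) :
    ∫ ω, (Real.exp (Y ω) + Real.exp (-Y ω)) ∂P ≤ 33 / 10 := by
  have h1 := hY.mgf_le 1
  have h2 := hY.mgf_le (-1)
  have h3 := hY.integrable_exp_mul 1
  have h4 := hY.integrable_exp_mul (-1)
  simp only [mgf, one_mul, neg_one_mul, NNReal.coe_one, one_pow, neg_sq] at h1 h2 h3 h4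
  rw [integral_add h3 h4]
  linarith [exp_half_le]

lemma integrable_exp_mul_abs_of_hasSubgaussianMGF {Y : Ω → ℝ} (hY : HasSubgaussianMGF Y 1 P)
    (t : ℝ) : Integrable (fun ω => Real.exp (t * |Y ω|)) P :=
  integrable_exp_mul_abs (hY.integrable_exp_mul t) (hY.integrable_exp_mul (-t))

lemma mgf_abs_one_le {Y : Ω → ℝ} (hY : HasSubgaussianMGF Y 1 P) :
    mgf (fun ω => |Y ω|) P 1 ≤ Real.exp 2 := by
  have h1 : mgf (fun ω => |Y ω|) P 1 ≤ ∫ ω, (Real.exp (Y ω) + Real.exp (-Y ω)) ∂P := by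
    refine integral_mono (integrable_exp_mul_abs_of_hasSubgaussianMGF hY 1)
      (integrable_exp_add_exp_neg hY) fun ω => ?_
    simpa using exp_abs_le_exp_add_exp_neg (Y ω)
  have h2 := integral_exp_add_exp_neg_le hY
  have h3 := Real.quadratic_le_exp_of_nonneg (x := 2) (by norm_num)
  linarith

/-- Numerically, `1 - 1/40 + (3/500) * (33/10) = 0.9948 ≤ 1 - 1/200`. -/
lemma mgf_abs_neg_le [IsProbabilityMeasure P] {Y : Ω → ℝ} (hY : HasSubgaussianMGF Y 1 P)
    (hsq : ∫ ω, Y ω ^ 2 ∂P = 1) : mgf (fun ω => |Y ω|) P (-1 / 10) ≤ Real.exp (-1 / 200) := by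
  have hint : Integrable (fun ω => Y ω ^ 2) P := (hY.memLp 2).integrable_sq
  have hint1 : Integrable (fun ω => 1 - Y ω ^ 2 / 40) P :=
    (integrable_const 1).sub (hint.div_const 40)
  have hint2 := (integrable_exp_add_exp_neg hY).const_mul (3 / 500)
  have h1 : mgf (fun ω => |Y ω|) P (-1 / 10)
      ≤ ∫ ω, (1 - Y ω ^ 2 / 40 + 3 / 500 * (Real.exp (Y ω) + Real.exp (-Y ω))) ∂P :=
    integral_mono (integrable_exp_mul_abs_of_hasSubgaussianMGF hY _) (hint1.add hint2)
      fun ω => exp_neg_abs_div_le (Y ω)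
  rw [integral_add hint1 hint2, integral_sub (integrable_const 1) (hint.div_const 40),
    integral_div, hsq, integral_const_mul] at h1
  have h2 := integral_exp_add_exp_neg_le hY
  have h3 := Real.add_one_le_exp (-1 / 200)
  simp at h1
  linarith

/-- Chernoff at `t = 1` gives `exp(-3n + 2n)` for the upper tail; at `t = -1/10` it gives `exp(n/400
- n/200)` for the lower tail. -/
lemma measureReal_sum_abs_notMem_le [IsProbabilityMeasure P] {n : ℕ} {Y : Fin n → Ω → ℝ}
    (hind : iIndepFun Y P) (hY : ∀ i, HasSubgaussianMGF (Y i) 1 P)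
    (hsq : ∀ i, ∫ ω, Y i ω ^ 2 ∂P = 1) :
    P.real {ω | ¬ ((n : ℝ) / 40 ≤ ∑ i, |Y i ω| ∧ ∑ i, |Y i ω| ≤ 3 * n)}
      ≤ 2 * Real.exp (-(n : ℝ) / 400) := by
  have hind' : iIndepFun (fun i ω => |Y i ω|) P :=
    hind.comp (fun _ y => |y|) fun _ => measurable_norm
  have hmeas : ∀ i, AEMeasurable (fun ω => |Y i ω|) P := fun i =>
    measurable_norm.comp_aemeasurable (hY i).aemeasurable
  have hint : ∀ t : ℝ, 
      Integrable (fun ω => Real.exp (t * (∑ i, fun ω => |Y i ω|) ω)) P := fun t => by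
    -- A non-integrable function has integral 0 by convention, while this moment generating function
    -- is a product of positive factors.
    refine Integrable.of_integral_ne_zero ?_
    change mgf (∑ i, fun ω => |Y i ω|) P t ≠ 0
    rw [hind'.mgf_sum₀ hmeas]
    exact (Finset.prod_pos fun i _ =>
      mgf_pos (integrable_exp_mul_abs_of_hasSubgaussianMGF (hY i) t)).ne'
  have hup := measure_ge_le_exp_mul_mgf (μ := P) (X := ∑ i, fun ω => |Y i ω|) (t := 1)
    (3 * (n : ℝ)) (by norm_num) (hint 1)
  have hlo := measure_le_le_exp_mul_mgf (μ := P) (X := ∑ i, fun ω => |Y i ω|) (t := -1 / 10)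
    ((n : ℝ) / 40) (by norm_num) (hint _)
  rw [hind'.mgf_sum₀ hmeas] at hup hlo
  have hup' : ∏ i, mgf (fun ω => |Y i ω|) P 1 ≤ ∏ _i : Fin n, Real.exp 2 :=
    Finset.prod_le_prod (fun _ _ => mgf_nonneg) fun i _ => mgf_abs_one_le (hY i)
  have hlo' : ∏ i, mgf (fun ω => |Y i ω|) P (-1 / 10) ≤ ∏ _i : Fin n, Real.exp (-1 / 200) :=
    Finset.prod_le_prod (fun _ _ => mgf_nonneg) fun i _ => mgf_abs_neg_le (hY i) (hsq i)
  rw [Finset.prod_const, Finset.card_univ, Fintype.card_fin, ← Real.exp_nat_mul] at hup' hlo'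
  have hup'' := hup.trans (mul_le_mul_of_nonneg_left hup' (Real.exp_pos _).le)
  have hlo'' := hlo.trans (mul_le_mul_of_nonneg_left hlo' (Real.exp_pos _).le)
  rw [← Real.exp_add] at hup'' hlo''
  have hsub : {ω | ¬ ((n : ℝ) / 40 ≤ ∑ i, |Y i ω| ∧ ∑ i, |Y i ω| ≤ 3 * n)}
      ⊆ {ω | 3 * (n : ℝ) ≤ (∑ i, fun ω => |Y i ω|) ω}
        ∪ {ω | (∑ i, fun ω => |Y i ω|) ω ≤ (n : ℝ) / 40} := by
    intro ω hω
    simp only [Set.mem_ofPred_eq, not_and_or, not_le, Set.mem_union, Finset.sum_apply] at hω ⊢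
    rcases hω with h | h
    · exact Or.inr h.le
    · exact Or.inl h.le
  refine (measureReal_mono hsub).trans ((measureReal_union_le _ _).trans ?_)
  rw [two_mul]
  refine add_le_add (hup''.trans ?_) (hlo''.trans ?_) <;> rw [Real.exp_le_exp] <;>
    linarith [(Nat.cast_nonneg n : (0 : ℝ) ≤ n)]

lemma hasSubgaussianMGF_sum_mul {κ : Type*} [Fintype κ] {X : κ → Ω → ℝ} {μ : Measure ℝ}
    (hμ : IsStandardSubgaussian μ) (hind : iIndepFun X P) (hX : ∀ q, HasLaw (X q) μ P)
    {w : κ → ℝ} (hw : ∑ q, w q ^ 2 = 1) :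
    HasSubgaussianMGF (fun ω => ∑ q, w q * X q ω) 1 P ∧
      ∫ ω, (∑ q, w q * X q ω) ^ 2 ∂P = 1 := by
  have hP := hind.isProbabilityMeasure
  have hXs : ∀ q, HasSubgaussianMGF (X q) 1 P := fun q => by
    have h := hμ.hasSubgaussianMGF
    rw [← (hX q).map_eq] at h
    exact HasSubgaussianMGF.of_map (X := fun x => x) (Y := X q) (hX q).aemeasurable h
  have hind' : iIndepFun (fun q ω => w q * X q ω) P :=
    hind.comp (fun q y => w q * y) fun q => measurable_const_mul (w q)
  have hwX : ∀ q, HasSubgaussianMGF (fun ω => w q * X q ω) (Real.toNNReal (w q ^ 2)) P := fun q =>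
    { integrable_exp_mul := fun t => by
        simpa [mul_assoc] using (hXs q).integrable_exp_mul (t * w q)
      mgf_le := fun t => by
        rw [mgf_const_mul]
        refine ((hXs q).mgf_le _).trans_eq ?_
        rw [Real.coe_toNNReal _ (sq_nonneg _), NNReal.coe_one, one_mul, mul_pow] }
  have hsub := HasSubgaussianMGF.sum_of_iIndepFun hind' (s := Finset.univ) fun q _ => hwX q
  rw [← Real.toNNReal_sum_of_nonneg fun q _ => sq_nonneg (w q), hw, Real.toNNReal_one] at hsub
  refine ⟨hsub, ?_⟩
  have hmean : ∀ q, ∫ ω, X q ω ∂P = 0 := fun q => by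
    rw [(hX q).integral_eq]
    exact hμ.integral_eq_zero
  have hvar : ∀ q, variance (X q) P = 1 := fun q => by
    rw [variance_of_integral_eq_zero (hX q).aemeasurable (hmean q)]
    have := (hX q).integral_comp (f := fun x => x ^ 2)
      (by fun_prop)
    rw [hμ.integral_sq_eq_one] at this
    exact this
  have hzero : ∫ ω, ∑ q, w q * X q ω ∂P = 0 := by
    rw [integral_finsetSum _ fun q _ => ((hXs q).integrable).const_mul (w q)]
    simp [integral_const_mul, hmean]
  rw [← variance_of_integral_eq_zero hsub.aemeasurable hzero]
  have hsumvar := IndepFun.variance_sum (μ := P) (X := fun q ω => w q * X q ω) (s := Finset.univ)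
    (fun q _ => (hwX q).memLp 2)
    fun q _ q' _ hne => hind'.indepFun hne
  have hfun : (∑ q, fun ω => w q * X q ω) = fun ω => ∑ q, w q * X q ω := by
    ext ω
    simp
  rw [hfun] at hsumvar
  rw [hsumvar, ← hw]
  refine Finset.sum_congr rfl fun q _ => ?_
  rw [variance_const_mul, hvar, mul_one]

/-- Coordinate `i` of `(Ψ h) x` is the sum of `x j * h l * Ψ j i l` over `(j, l)`. The weights `x j
* h l` have Euclidean norm `‖x‖₂‖h‖₂ = r`, so division by `r` yields independent sub-Gaussian
variables of unit variance. -/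
lemma HasIIDEntries.measureReal_measurementMap_notMem_le [IsProbabilityMeasure P] {n m N : ℕ}
    {μ : Measure ℝ} (hμ : IsStandardSubgaussian μ) {Ψ : Ω → Fin N → Matrix (Fin n) (Fin m) ℝ}
    (hΨ : HasIIDEntries μ P Ψ) {h : Fin m → ℝ} (hh : h ≠ 0) {x : Fin N → ℝ} (hx : x ≠ 0) :
    P.real {ω | ¬ (n * l2norm h / 40 * l2norm x
          ≤ ‖measurementMap ℝ (dictionaryMatrix (Ψ ω) h) x‖ ∧
        ‖measurementMap ℝ (dictionaryMatrix (Ψ ω) h) x‖ ≤ 3 * (n * l2norm h) * l2norm x)}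
      ≤ 2 * Real.exp (-(n : ℝ) / 400) := by
  have hhpos : 0 < l2norm h :=
    lt_of_le_of_ne (l2norm_nonneg h) fun h0 => hh (l2norm_eq_zero.1 h0.symm)
  have hxpos : 0 < l2norm x :=
    lt_of_le_of_ne (l2norm_nonneg x) fun h0 => hx (l2norm_eq_zero.1 h0.symm)
  set r : ℝ := l2norm x * l2norm h with hr
  have hrpos : 0 < r := mul_pos hxpos hhpos
  set w : Fin N × Fin m → ℝ := fun q => x q.1 * h q.2 / r with hwdef
  have hw : ∑ q, w q ^ 2 = 1 := by
    simp only [hwdef, div_pow, mul_pow]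
    rw [← Finset.sum_div, Fintype.sum_prod_type]
    simp only [← Finset.mul_sum, ← Finset.sum_mul]
    have h1 := l2norm_sq x
    have h2 := l2norm_sq h
    simp only [Real.norm_eq_abs, sq_abs] at h1 h2
    rw [← h1, ← h2, hr, mul_pow]
    field_simp
  set X : Fin n × (Fin N × Fin m) → Ω → ℝ := fun p ω => Ψ ω p.2.1 p.1 p.2.2 with hX
  have hXind : iIndepFun X P :=
    hΨ.1.precomp (g := fun p : Fin n × (Fin N × Fin m) => (p.2.1, p.1, p.2.2)) fun p p' hp => by
      simp only [Prod.mk.injEq] at hp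
      ext <;> simp [hp]
  have hXlaw : ∀ p, HasLaw (X p) μ P := fun p => hΨ.2 p.2.1 p.1 p.2.2
  have hYind : iIndepFun (fun i ω => ∑ q, w q * X (i, q) ω) P :=
    (iIndepFun_curry (fun p => (hXlaw p).aemeasurable) hXind).comp
      (fun _ y => ∑ q, w q * y q) fun _ => by fun_prop
  have hY := fun i => hasSubgaussianMGF_sum_mul hμ (hXind.precomp (Prod.mk_right_injective i))
    (fun q => hXlaw (i, q)) hw
  refine le_trans (le_of_eq ?_)
    (measureReal_sum_abs_notMem_le hYind (fun i => (hY i).1) fun i => (hY i).2)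
  congr 1
  ext ω
  have hsum : ‖measurementMap ℝ (dictionaryMatrix (Ψ ω) h) x‖
      = r * ∑ i, |∑ q, w q * X (i, q) ω| := by
    rw [norm_measurementMap_real, Finset.mul_sum]
    refine Finset.sum_congr rfl fun i _ => ?_
    refine Eq.trans ?_ (congrArg (· * _) (abs_of_pos hrpos))
    rw [← abs_mul, Finset.mul_sum, Fintype.sum_prod_type]
    congr 1
    simp only [Matrix.mulVec, dictionaryMatrix, dotProduct, Matrix.of_apply, Finset.sum_mul,
      hwdef, hX]
    refine Finset.sum_congr rfl fun j _ => Finset.sum_congr rfl fun l _ => ?_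
    field_simp
  simp only [Set.mem_ofPred_eq]
  rw [hsum]
  have h1 : n * l2norm h / 40 * l2norm x = r * (n / 40) := by rw [hr]; ring
  have h2 : 3 * (n * l2norm h) * l2norm x = r * (3 * n) := by rw [hr]; ring
  rw [h1, h2, mul_le_mul_iff_right₀ hrpos, mul_le_mul_iff_right₀ hrpos]

end Concentration

/-! ### The union bound and the final assembly. -/

lemma log_le_div_of_large {n : ℝ} (hn : 40960000 ≤ n) : Real.log n ≤ n / 3200 := by
  have hs : (6400 : ℝ) ≤ √n := Real.le_sqrt_of_sq_le (by norm_num; linarith)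
  have h1 := Real.log_le_sub_one_of_pos (by linarith : 0 < √n)
  rw [Real.log_sqrt (by linarith)] at h1
  have h2 := Real.mul_self_sqrt (by linarith : 0 ≤ n)
  nlinarith [mul_le_mul_of_nonneg_left hs (Real.sqrt_nonneg n)]

/-- The exponent `n/400` is four times `n/1600`. One share pays for each of `(t^(Kk))⁻¹`, `exp(4tN)`
and the factor 2; the last leaves `exp(-n/1600) ≤ ε`. -/
lemma card_latticeBall_mul_le {n N k K : ℕ} (hn : 0 < n) (hN : 0 < N) (hk : 0 < k) (hK : 3 ≤ K)
    {ε : ℝ} (hε : 0 < ε) (hε1 : ε < 1)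
    (h : (k : ℝ) ≤ 1 / (20000000 * K) * (n / max 1 (Real.log (N / (n * ε))))) :
    ((latticeBall (Fin N) (K * k)).card : ℝ) * (2 * Real.exp (-(n : ℝ) / 400)) ≤ ε := by
  set L := max 1 (Real.log (N / (n * ε))) with hL
  have hn' : (0 : ℝ) < n := by exact_mod_cast hn
  have hN' : (1 : ℝ) ≤ N := by exact_mod_cast hN
  have hk' : (1 : ℝ) ≤ k := by exact_mod_cast hk
  have hK' : (3 : ℝ) ≤ K := by exact_mod_cast hK
  have hL1 : 1 ≤ L := le_max_left _ _
  have hkL : 20000000 * (K * (k * L)) ≤ n := by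
    have h1 : 1 / (20000000 * K) * (n / L) = n / (20000000 * K * L) := by field_simp
    rw [h1, le_div_iff₀ (by positivity)] at h
    linarith
  have hkL' : L ≤ k * L := le_mul_of_one_le_left (by linarith) hk'
  have hKkL : 3 * L ≤ K * (k * L) := by
    refine mul_le_mul hK' hkL' (by linarith) (by linarith)
  have hnbig : (60000000 : ℝ) ≤ n := by linarith
  -- With `k ≥ 1` the hypothesis makes `n` large and `L` small relative to `n`, so `ε` cannot be
  -- below `exp(-n/1600)`.
  have hlogε : -Real.log ε ≤ n / 1600 := by
    have h1 : Real.log (N / (n * ε)) = Real.log N - (Real.log n + Real.log ε) := by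
      rw [Real.log_div (by positivity) (by positivity), Real.log_mul (by positivity) hε.ne']
    have h2 : Real.log (N / (n * ε)) ≤ L := le_max_right _ _
    have h3 := Real.log_nonneg hN'
    have h4 := log_le_div_of_large (by linarith : (40960000 : ℝ) ≤ n)
    linarith
  -- Taking the maximum with `n` keeps `Q ≥ 1`, hence `t ≤ 1/2`, also when `N < n`.
  set Q : ℝ := max (n : ℝ) (N : ℝ) / n with hQ
  have hQ1 : 1 ≤ Q := by
    rw [hQ, le_div_iff₀ hn', one_mul]
    exact le_max_left _ _
  have hlogQ : Real.log Q ≤ L := by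
    rcases le_total (n : ℝ) N with hnN | hnN
    · rw [hQ, max_eq_right hnN]
      refine le_trans (Real.log_le_log (by positivity) ?_) (le_max_right _ _)
      refine div_le_div_of_nonneg_left (by linarith) (by positivity) ?_
      exact mul_le_of_le_one_right hn'.le hε1.le
    · rw [hQ, max_eq_left hnN, div_self hn'.ne', Real.log_one]
      linarith
  set t : ℝ := (6400 * Q)⁻¹ with ht
  have htpos : 0 < t := by positivity
  have ht2 : t ≤ 1 / 2 := by
    rw [ht, one_div]
    exact inv_anti₀ (by norm_num) (by linarith)
  have htN : 4 * t * N ≤ n / 1600 := by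
    have h1 : (N : ℝ) ≤ Q * n := by
      rw [hQ, div_mul_cancel₀ _ hn'.ne']
      exact le_max_right _ _
    have h2 : 4 * t * N = N / (1600 * Q) := by rw [ht]; field_simp; norm_num
    rw [h2, div_le_div_iff₀ (by positivity) (by norm_num)]
    nlinarith
  have hpow : (t ^ (K * k))⁻¹ = Real.exp (K * k * Real.log (6400 * Q)) := by
    rw [← inv_pow, ht, inv_inv, mul_comm ((K : ℝ) * k), ← Nat.cast_mul, Real.exp_mul,
      Real.exp_log (by positivity), Real.rpow_natCast]
  -- This needs `6400 * 1600 ≤ 20000000`.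
  have hlog : K * k * Real.log (6400 * Q) ≤ n / 1600 := by
    have h1 : Real.log (6400 * Q) ≤ 6400 * L := by
      rw [Real.log_mul (by norm_num) (by positivity)]
      have := Real.log_le_sub_one_of_pos (by norm_num : (0 : ℝ) < 6400)
      linarith
    calc K * k * Real.log (6400 * Q) ≤ K * k * (6400 * L) := by gcongr
      _ ≤ n / 1600 := by linarith
  have htwo : (2 : ℝ) ≤ Real.exp (n / 1600) := by
    have := Real.add_one_le_exp ((n : ℝ) / 1600)
    linarith
  have hcard := card_latticeBall_le (ι := Fin N) (K * k) htpos ht2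
  rw [Fintype.card_fin, hpow] at hcard
  calc ((latticeBall (Fin N) (K * k)).card : ℝ) * (2 * Real.exp (-(n : ℝ) / 400))
      ≤ (Real.exp (n / 1600) * Real.exp (n / 1600))
          * (Real.exp (n / 1600) * Real.exp (-(n : ℝ) / 400)) := by
        refine mul_le_mul (hcard.trans ?_) ?_ (by positivity) (by positivity)
        · gcongr
        · gcongr
    _ = Real.exp (-(n / 1600)) := by
        rw [← Real.exp_add, ← Real.exp_add, ← Real.exp_add]
        congr 1
        ring
    _ ≤ Real.exp (Real.log ε) := by
        rw [Real.exp_le_exp]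
        linarith
    _ = ε := Real.exp_log hε

lemma dictionaryMatrix_map_algebraMap {𝕜 : Type*} [RCLike 𝕜] {n m N : ℕ}
    (Ψ : Fin N → Matrix (Fin n) (Fin m) ℝ) (h : Fin m → ℝ) :
    dictionaryMatrix (fun j => (Ψ j).map (algebraMap ℝ 𝕜)) (fun l => algebraMap ℝ 𝕜 (h l))
      = (dictionaryMatrix Ψ h).map (algebraMap ℝ 𝕜) := by
  ext i j
  simp [dictionaryMatrix, Matrix.mulVec, dotProduct]

theorem basisPursuitRecoversAll_of_latticeBall {𝕜 : Type*} [RCLike 𝕜] {n m N k D : ℕ}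
    (hn : 0 < n) (hk : 0 < k) (hD : 4000000 ≤ D) {Ψ : Fin N → Matrix (Fin n) (Fin m) ℝ}
    {h : Fin m → ℝ} (hh : h ≠ 0)
    (hz : ∀ z ∈ latticeBall (Fin N) (500 * (D + 1) * k), z ≠ 0 →
      n * l2norm h / 40 * l2norm (fun j => (z j : ℝ))
          ≤ ‖measurementMap ℝ (dictionaryMatrix Ψ h) fun j => (z j : ℝ)‖ ∧
        ‖measurementMap ℝ (dictionaryMatrix Ψ h) fun j => (z j : ℝ)‖
          ≤ 3 * (n * l2norm h) * l2norm (fun j => (z j : ℝ))) :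
    BasisPursuitRecoversAll (fun j => (Ψ j).map (algebraMap ℝ 𝕜))
      (fun l => algebraMap ℝ 𝕜 (h l)) k := by
  have hhpos : 0 < l2norm h :=
    lt_of_le_of_ne (l2norm_nonneg h) fun h0 => hh (l2norm_eq_zero.1 h0.symm)
  have hγ : 0 < n * l2norm h := mul_pos (by exact_mod_cast hn) hhpos
  have hreal : HasSparseBounds (measurementMap ℝ (dictionaryMatrix Ψ h)) ((D + 1) * k)
      (n * l2norm h / 40 / 2) (2 * (3 * (n * l2norm h))) := by
    -- In units of `n * l2norm h`: `(1/40 + 6) / 500 = 0.01205 ≤ 1/80`.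
    refine hasSparseBounds_of_lattice (q := 500) (by positivity) (by positivity) (by norm_num)
      (by push_cast; linarith) fun z hzR => ?_
    rcases eq_or_ne z 0 with rfl | hz0
    · have h0 : (fun j : Fin N => (((0 : Fin N → ℤ) j : ℤ) : ℝ)) = 0 := by ext; simp
      rw [h0, map_zero, l2norm_eq_zero.2 rfl]
      simp
    · exact hz z (mem_latticeBall.2 (by rwa [mul_assoc])) hz0
  have hbounds := hasSparseBounds_measurementMap (𝕜 := 𝕜) hreal (by positivity) (by positivity)
  refine basisPursuitRecoversAll_of_nullSpaceProperty fun w hw hw0 S hS => ?_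
  rw [dictionaryMatrix_map_algebraMap] at hw
  refine sum_norm_lt_sum_compl_norm hbounds hk (by positivity) (by positivity) ?_
    (measurementMap_eq_zero hw) hw0 hS
  -- After the net and the complex transfer, `β / α = 12 / (1/160) = 1920`, and `1920² = 3686400 <
  -- 4000000`.
  have hD' : (4000000 : ℝ) ≤ D := by exact_mod_cast hD
  have := mul_le_mul_of_nonneg_right hD' (sq_nonneg (n * l2norm h / 40 / 2 / 2))
  nlinarith [sq_pos_of_pos hγ]

lemma basisPursuitRecoversAll_zero {𝕜 : Type*} [RCLike 𝕜] {n m N : ℕ}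
    (Ψ : Fin N → Matrix (Fin n) (Fin m) 𝕜) (h : Fin m → 𝕜) : BasisPursuitRecoversAll Ψ h 0 := by
  refine basisPursuitRecoversAll_of_nullSpaceProperty fun w _ hw0 S hS => ?_
  obtain ⟨j, hj⟩ := Function.ne_iff.1 hw0
  rw [Finset.card_eq_zero.1 (Nat.le_zero.1 hS), Finset.sum_empty, Finset.compl_empty]
  exact Finset.sum_pos' (fun _ _ => norm_nonneg _) ⟨j, Finset.mem_univ j, norm_pos_iff.2 hj⟩

theorem HasIIDEntries.exists_measurableSet_recoversAll {𝕜 : Type*} [RCLike 𝕜] {Ω : Type*}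
    [MeasurableSpace Ω] {P : Measure Ω} [IsProbabilityMeasure P] {n m N k D : ℕ} {μ : Measure ℝ}
    (hμ : IsStandardSubgaussian μ) {Ψ : Ω → Fin N → Matrix (Fin n) (Fin m) ℝ}
    (hΨ : HasIIDEntries μ P Ψ) (hn : 0 < n) (hN : 0 < N) (hk : 0 < k) (hD : 4000000 ≤ D)
    {h : Fin m → ℝ} (hh : h ≠ 0) {ε : ℝ} (hε : 0 < ε) (hε1 : ε < 1)
    (hkn : (k : ℝ) ≤ 1 / (20000000 * (500 * (D + 1) : ℕ))
      * (n / max 1 (Real.log (N / (n * ε))))) :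
    ∃ E : Set Ω, MeasurableSet E ∧ 1 - ε ≤ P.real E ∧
      ∀ ω ∈ E, BasisPursuitRecoversAll (fun j => (Ψ ω j).map (algebraMap ℝ 𝕜))
        (fun l => algebraMap ℝ 𝕜 (h l)) k := by
  set Z := (latticeBall (Fin N) (500 * (D + 1) * k)).filter (· ≠ 0) with hZ
  set bad : (Fin N → ℤ) → Set Ω := fun z =>
    {ω | ¬ (n * l2norm h / 40 * l2norm (fun j => (z j : ℝ))
          ≤ ‖measurementMap ℝ (dictionaryMatrix (Ψ ω) h) fun j => (z j : ℝ)‖ ∧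
        ‖measurementMap ℝ (dictionaryMatrix (Ψ ω) h) fun j => (z j : ℝ)‖
          ≤ 3 * (n * l2norm h) * l2norm (fun j => (z j : ℝ)))} with hbad
  set B : Set Ω := ⋃ z ∈ Z, bad z with hB
  have hBle : P.real B ≤ ε := by
    calc P.real B ≤ ∑ z ∈ Z, P.real (bad z) := measureReal_biUnion_finset_le Z bad
      _ ≤ ∑ _z ∈ Z, 2 * Real.exp (-(n : ℝ) / 400) := by
          refine Finset.sum_le_sum fun z hz => ?_
          refine hΨ.measureReal_measurementMap_notMem_le hμ hh fun h0 => ?_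
          refine (Finset.mem_filter.1 hz).2 (funext fun j => ?_)
          simpa using congrFun h0 j
      _ = Z.card * (2 * Real.exp (-(n : ℝ) / 400)) := by rw [Finset.sum_const, nsmul_eq_mul]
      _ ≤ (latticeBall (Fin N) (500 * (D + 1) * k)).card * (2 * Real.exp (-(n : ℝ) / 400)) := by
          gcongr
          exact Finset.filter_subset _ _
      _ ≤ ε := card_latticeBall_mul_le hn hN hk (by omega) hε hε1 hkn
  -- A measurable hull of `B` has the same measure, so measurability of the bad events is not
  -- needed.
  refine ⟨(toMeasurable P B)ᶜ, (measurableSet_toMeasurable P B).compl, ?_, fun ω hω => ?_⟩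
  · rw [measureReal_compl (measurableSet_toMeasurable P B), probReal_univ, measureReal_def,
      measure_toMeasurable, ← measureReal_def]
    linarith
  · have hωB : ω ∉ B := fun hB' => hω (subset_toMeasurable P B hB')
    refine basisPursuitRecoversAll_of_latticeBall hn hk hD hh fun z hz hz0 => ?_
    by_contra hcon
    exact hωB (Set.mem_biUnion (Finset.mem_filter.2 ⟨hz, hz0⟩ : z ∈ Z) hcon)

end SparseMatrixIdentification

theorem mainTheorem4 (𝕜 : Type*) [RCLike 𝕜] :
    ∃ c : ℝ, 0 < c ∧
      ∀ (n m N : ℕ), 0 < n → 0 < N →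
      ∀ h : Fin m → ℝ, h ≠ 0 →
      ∀ {Ω : Type*} [MeasurableSpace Ω] (P : Measure Ω) [IsProbabilityMeasure P]
        (Ψ : Ω → Fin N → Matrix (Fin n) (Fin m) ℝ),
        SparseMatrixIdentification.IsGaussianEnsemble P Ψ ∨
          SparseMatrixIdentification.IsBernoulliEnsemble P Ψ →
      ∀ ε : ℝ, 0 < ε →
      ∀ k : ℕ, (k : ℝ) ≤ c * (n / max 1 (Real.log (N / (n * ε)))) →
        ∃ E : Set Ω, MeasurableSet E ∧ 1 - ε ≤ P.real E ∧
          ∀ ω ∈ E, SparseMatrixIdentification.BasisPursuitRecoversAll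
            (fun j => (Ψ ω j).map (algebraMap ℝ 𝕜)) (fun l => algebraMap ℝ 𝕜 (h l)) k := by
  obtain ⟨D, hD⟩ : ∃ D : ℕ, 4000000 ≤ D := ⟨_, le_rfl⟩
  refine ⟨1 / (20000000 * (500 * (D + 1) : ℕ)), by positivity, ?_⟩
  intro n m N hn hN h hh Ω _ P _ Ψ hΨ ε hε k hk
  -- For `k = 0` the bound on `k` does not force `n` to be large, so this case is handled
  -- deterministically; for `ε ≥ 1` the empty event suffices.
  rcases Nat.eq_zero_or_pos k with rfl | hk0
  · refine ⟨Set.univ, MeasurableSet.univ, ?_, fun ω _ =>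
      SparseMatrixIdentification.basisPursuitRecoversAll_zero _ _⟩
    rw [probReal_univ]
    linarith
  rcases le_or_gt 1 ε with hε1 | hε1
  · refine ⟨∅, MeasurableSet.empty, ?_, by simp⟩
    rw [measureReal_empty]
    linarith
  rcases hΨ with hΨ | hΨ
  · exact SparseMatrixIdentification.HasIIDEntries.exists_measurableSet_recoversAll
      SparseMatrixIdentification.isStandardSubgaussian_gaussianReal hΨ hn hN hk0 hD hh hε hε1 hk
  · exact SparseMatrixIdentification.HasIIDEntries.exists_measurableSet_recoversAll
      SparseMatrixIdentification.isStandardSubgaussian_signMeasure hΨ hn hN hk0 hD hh hε hε1 hk
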